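/- Let $p \ge 1$, let $\mathcal{A}$ be a Borel set of real $p \times p$ matrices, and let $(A_n)_{n \ge 1}$ be an i.i.d. sequence of $\mathcal{A}$-valued random matrices such that: - every matrix in $\mathcal{A}$ is non-negative, column-stochastic (each column sums to $1$) and allowable (each row and each column contains a strictly positive entry); - $\mathcal{A}$ is primitive, i.e. some finite product of elements of $\mathcal{A}$, repetitions allowed, is entrywise strictly positive; - the distribution of $A_1$ is fully supported on $\mathcal{A}$, i.e. every point of $\mathcal{A}$ lies in the support of the law of $A_1$; - with $\alpha_n = \min_{i,j}\{A_n^{i,j} : A_n^{i,j} \ne 0\}$ and $\log^- t = \min(\log t, 0)$, one has $\mathbb{E} \log^- \alpha_1 > -\infty$. Let $x_0 \in \mathbb{R}^p$, $w_0 = \mathbf{1} = (1,\dots,1)^\top$, and for $n \ge 1$ let $x_n = A_n x_{n-1}$, $w_n = A_n w_{n-1}$. Put $\bar x = \frac1p \sum_{i=1}^p x_0^i$, let $I$ be the $p \times p$ identity matrix, $J = \mathbf{1}\mathbf{1}^\top/p$, and $$\eta_2 = \log \rho\left(\mathbb{E}(A_1^{\otimes 2})\,(I-J)^{\otimes 2}\right)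 \in [-\infty, \infty),$$ where $\otimes$ is the Kronecker product, $\rho$ is the spectral radius (the largest modulus of a complex eigenvalue), and $\log 0 = -\infty$. Then almost surely $$\limsup_{n\to\infty} \frac 1 n \log \sum_{i=1}^p \left|\frac{x_n^i}{w_n^i} - \bar x\right| \le \frac{\eta_2}{2},$$ and moreover $\frac{\eta_2}{2} < 0$. -/

import Mathlib

open MeasureTheory Filter
open scoped Matrix Kronecker ENNReal

namespace RatioConsensus

/-- Real matrices carry the product σ-algebra, which is their Borel σ-algebra. -/
instance matrixMeasurableSpace (p : ℕ) : MeasurableSpace (Matrix (Fin p) (Fin p) ℝ) :=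
  inferInstanceAs (MeasurableSpace (Fin p → Fin p → ℝ))

instance matrixBorelSpace (p : ℕ) : BorelSpace (Matrix (Fin p) (Fin p) ℝ) :=
  inferInstanceAs (BorelSpace (Fin p → Fin p → ℝ))

/-- A real matrix is allowable if every row and every column contains at least one strictly
positive entry (the notion is used for entrywise non-negative matrices). -/
def Allowable {p : ℕ} (M : Matrix (Fin p) (Fin p) ℝ) : Prop :=
  (∀ i, ∃ j, 0 < M i j) ∧ (∀ j, ∃ i, 0 < M i j)

/-- A set of non-negative matrices is primitive if some product of (one or more) of its elements,
repetitions allowed, is entrywise strictly positive. -/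
def PrimitiveSet {p : ℕ} (𝒜 : Set (Matrix (Fin p) (Fin p) ℝ)) : Prop :=
  ∃ l : List (Matrix (Fin p) (Fin p) ℝ), l ≠ [] ∧ (∀ M ∈ l, M ∈ 𝒜) ∧ ∀ i j, 0 < l.prod i j

/-- The smallest non-zero entry `min {M i j : M i j ≠ 0}` (a minimum over a finite set, which is
non-empty for the matrices considered). -/
noncomputable def minNonzeroEntry {p : ℕ} (M : Matrix (Fin p) (Fin p) ℝ) : ℝ :=
  sInf {t : ℝ | ∃ i j, M i j = t ∧ M i j ≠ 0}

/-- The (non-positive) negative part of the logarithm, `log⁻ t = min (log t) 0`. -/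
noncomputable def logMinus (t : ℝ) : ℝ := min (Real.log t) 0

/-- The standing assumption on the set `𝒜` of matrices and on the random matrices
`A 0, A 1, A 2, …`, which are the update matrices `A₁, A₂, A₃, …` of the process. -/
structure StandingAssumption {p : ℕ} {Ω : Type*} [MeasurableSpace Ω] (P : Measure Ω)
    (𝒜 : Set (Matrix (Fin p) (Fin p) ℝ)) (A : ℕ → Ω → Matrix (Fin p) (Fin p) ℝ) : Prop where
  /-- `𝒜` is a Borel set of matrices. -/
  borel : MeasurableSet 𝒜
  /-- All matrices in `𝒜` are non-negative with all column sums equal to `1`. -/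
  columnStochastic : ∀ M ∈ 𝒜, M ∈ Matrix.colStochastic ℝ (Fin p)
  /-- All matrices in `𝒜` are allowable. -/
  allowable : ∀ M ∈ 𝒜, Allowable M
  /-- `𝒜` is primitive. -/
  primitive : PrimitiveSet 𝒜
  /-- The process consists of random matrices. -/
  measurable : ∀ n, Measurable (A n)
  /-- The random matrices take values in `𝒜` (almost surely). -/
  mem : ∀ n, ∀ᵐ ω ∂P, A n ω ∈ 𝒜
  /-- The random matrices are independent. -/
  indep : ProbabilityTheory.iIndepFun A P
  /-- The random matrices are identically distributed. -/
  identDistrib : ∀ n, ProbabilityTheory.IdentDistrib (A n) (A 0) P P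
  /-- The law of `A₁` is fully supported on `𝒜`: every point of `𝒜` lies in its support. -/
  fullSupport : 𝒜 ⊆ (P.map (A 0)).support
  /-- `log⁻` of the smallest non-zero entry of `A₁` has finite expectation. -/
  logIntegrable : Integrable (fun ω => logMinus (minNonzeroEntry (A 0 ω))) P

/-- The trajectory `v₀ = v`, `vₙ₊₁ = Aₙ₊₁ vₙ`, for a sequence `a` with `a n = Aₙ₊₁`. -/
noncomputable def trajectory {p : ℕ} (a : ℕ → Matrix (Fin p) (Fin p) ℝ) (v : Fin p → ℝ) :
    ℕ → Fin p → ℝ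
  | 0 => v
  | n + 1 => a n *ᵥ trajectory a v n

/-- The average `x̄` of the entries of a vector. -/
noncomputable def average {p : ℕ} (x : Fin p → ℝ) : ℝ := (∑ i, x i) / p

/-- The total error `∑ᵢ |xₙⁱ / wₙⁱ - x̄|` of ratio consensus after `n` steps, where `x` starts at
`x₀` and the weights `w` start at the all-ones vector. -/
noncomputable def consensusError {p : ℕ} (a : ℕ → Matrix (Fin p) (Fin p) ℝ) (x₀ : Fin p → ℝ)
    (n : ℕ) : ℝ :=
  ∑ i, |trajectory a x₀ n i / trajectory a 1 n i - average x₀|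

/-- The matrix `J = 𝟏𝟏ᵀ / p`. -/
noncomputable def averagingMatrix (p : ℕ) : Matrix (Fin p) (Fin p) ℝ :=
  Matrix.of fun _ _ => 1 / (p : ℝ)

/-- The entrywise expectation `𝔼 (X ⊗ X)` of the Kronecker square of a random matrix. -/
noncomputable def expectedKroneckerSquare {p : ℕ} {Ω : Type*} [MeasurableSpace Ω] (P : Measure Ω)
    (X : Ω → Matrix (Fin p) (Fin p) ℝ) : Matrix (Fin p × Fin p) (Fin p × Fin p) ℝ :=
  Matrix.of fun i j => ∫ ω, (X ω ⊗ₖ X ω) i j ∂P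

/-- `η₂ = log ρ(𝔼(X ⊗ X) (I - J) ⊗ (I - J))`, an extended real number, with `log 0 = -∞`. Here
`ρ` is the largest modulus of a complex eigenvalue. -/
noncomputable def etaTwo {p : ℕ} {Ω : Type*} [MeasurableSpace Ω] (P : Measure Ω)
    (X : Ω → Matrix (Fin p) (Fin p) ℝ) : EReal :=
  ENNReal.log (spectralRadius ℂ
    ((expectedKroneckerSquare P X *
      ((1 - averagingMatrix p) ⊗ₖ (1 - averagingMatrix p))).map Complex.ofReal))

end RatioConsensus

/-! Write `x_n - x̄ w_n` as the trajectory `y_n` started at the zero-sum vector `x₀ - x̄ 𝟏`. The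
error is then the sum of the `|y_n^i| / w_n^i`, so it suffices that `y_n` decays at rate at most
`η₂/2` and that no `w_n^i` decays exponentially.

Numerator: by independence, the second moments of `y_n` are `K ^ n` applied to `y₀ ⊗ y₀`, with `K =
𝔼(A₁ ⊗ A₁)`. On such tensors of zero-sum vectors `K` acts as `K Q`, where `Q = (I - J) ⊗ (I - J)`.
Gelfand's formula bounds the moments (`second_moment_le`), and Markov's inequality with
Borel–Cantelli makes the bound almost sure.

Denominator: an all-positive block product has positive probability, so such blocks have positive
density, and one occurs between times `θ n` and `n` for every fixed `θ < 1`. The product over that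
window is then entrywise positive, and its entries are at least the exponential of a sum of `log⁻
α_k` over about `(1 - θ) n` indices. By the law of large numbers this costs an arbitrarily small
rate (`eventually_exp_le_trajectory_one`).

Negativity: `K` is column-stochastic and primitivity makes one of its powers positive, so it
strictly contracts zero-sum eigenvectors. Every eigenvector of `K Q` with non-zero eigenvalue is one
of these (`spectralRadius_lt_one`). -/

namespace RatioConsensus

open Matrix

/-! ### Spectral facts about a fixed matrix. -/

section Deterministic

lemma map_ofReal_mul {m : Type*} [Fintype m] (M N : Matrix m m ℝ) :
    (M * N).map Complex.ofReal = M.map Complex.ofReal * N.map Complex.ofReal :=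
  Matrix.map_mul (f := Complex.ofRealHom)

variable {ι : Type*} [Fintype ι] [DecidableEq ι]

lemma map_ofReal_pow (M : Matrix ι ι ℝ) (n : ℕ) :
    (M ^ n).map Complex.ofReal = (M.map Complex.ofReal) ^ n :=
  map_pow (Complex.ofRealHom.mapMatrix (m := ι)) M n

lemma pow_mulVec_eigenvector {M : Matrix ι ι ℂ} {v : ι → ℂ} {μ : ℂ} (h : M *ᵥ v = μ • v) (n : ℕ) :
    (M ^ n) *ᵥ v = μ ^ n • v := by
  induction n with
  | zero => simp
  | succ n ih => rw [pow_succ, ← mulVec_mulVec, h, mulVec_smul, ih, smul_smul, pow_succ']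

/-- A column-stochastic matrix with a positive power contracts zero-sum eigenvectors. -/
lemma norm_lt_one_of_eigenvector {K : Matrix ι ι ℝ} (hK : K ∈ colStochastic ℝ ι) {N : ℕ}
    (hpos : ∀ i j, 0 < (K ^ N) i j) {v : ι → ℂ} (hv : v ≠ 0) (hsum : ∑ i, v i = 0) {μ : ℂ}
    (h : K.map Complex.ofReal *ᵥ v = μ • v) : ‖μ‖ < 1 := by
  obtain ⟨i₀, hi₀⟩ := Function.ne_iff.1 hv
  have : Nonempty ι := ⟨i₀⟩
  have hT : K ^ N ∈ colStochastic ℝ ι := pow_mem hK N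
  set T := K ^ N
  obtain ⟨q, hq⟩ := Finite.exists_min (fun q : ι × ι => T q.1 q.2)
  set δ := T q.1 q.2
  have hδ : 0 < δ := hpos _ _
  have hv1 : 0 < ∑ i, ‖v i‖ :=
    Finset.sum_pos' (fun _ _ => norm_nonneg _) ⟨i₀, Finset.mem_univ _, norm_pos_iff.2 hi₀⟩
  have hN : T.map Complex.ofReal *ᵥ v = μ ^ N • v := by
    rw [map_ofReal_pow, pow_mulVec_eigenvector h]
  have hbound : ∀ i, ‖μ‖ ^ N * ‖v i‖ ≤ ∑ j, (T i j - δ) * ‖v j‖ := by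
    intro i
    -- Since `v` sums to zero, subtracting the constant `δ` from each row of `T` does not change `T
    -- v`; this lowers the column sums to `1 - card ι * δ`.
    have h1 : μ ^ N * v i = ∑ j, ((T i j - δ : ℝ) : ℂ) * v j := by
      have := congrFun hN i
      simp only [mulVec, dotProduct, map_apply, Pi.smul_apply, smul_eq_mul] at this
      rw [← this]
      simp only [Complex.ofReal_sub, sub_mul, Finset.sum_sub_distrib, ← Finset.mul_sum, hsum,
        mul_zero, sub_zero]
    rw [← norm_pow, ← norm_mul, h1]
    refine (norm_sum_le _ _).trans (Finset.sum_le_sum fun j _ => ?_)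
    rw [norm_mul, Complex.norm_real, Real.norm_of_nonneg (sub_nonneg.2 (hq (i, j)))]
  have hcard : (0 : ℝ) < Fintype.card ι := by exact_mod_cast Fintype.card_pos
  have htot : ‖μ‖ ^ N * ∑ i, ‖v i‖ ≤ (1 - Fintype.card ι * δ) * ∑ i, ‖v i‖ := by
    calc ‖μ‖ ^ N * ∑ i, ‖v i‖ = ∑ i, ‖μ‖ ^ N * ‖v i‖ := Finset.mul_sum _ _ _
      _ ≤ ∑ i, ∑ j, (T i j - δ) * ‖v j‖ := Finset.sum_le_sum fun i _ => hbound i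
      _ = ∑ j, ∑ i, (T i j - δ) * ‖v j‖ := Finset.sum_comm
      _ = _ := by
        rw [Finset.mul_sum]
        refine Finset.sum_congr rfl fun j _ => ?_
        rw [← Finset.sum_mul, Finset.sum_sub_distrib, (mem_colStochastic_iff_sum.1 hT).2 j]
        simp
  have h2 := le_of_mul_le_mul_right htot hv1
  by_contra! hμ
  have := one_le_pow₀ hμ (n := N)
  nlinarith

/-- The supremum defining the spectral radius is attained when the spectrum is non-empty, so strict
bounds on single eigenvalues survive. -/
lemma spectralRadius_lt_one_of_forall {M : Matrix ι ι ℂ}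
    (h : ∀ (μ : ℂ) (v : ι → ℂ), v ≠ 0 → M *ᵥ v = μ • v → ‖μ‖ < 1) : spectralRadius ℂ M < 1 := by
  have hspec : ∀ μ ∈ spectrum ℂ M, ‖μ‖ < 1 := by
    intro μ hμ
    rw [← Matrix.spectrum_toLin', ← Module.End.hasEigenvalue_iff_mem_spectrum] at hμ
    obtain ⟨v, hv⟩ := hμ.exists_hasEigenvector
    exact h μ v hv.2 (by simpa using hv.apply_eq_smul)
  let _ := Matrix.linftyOpNormedRing (n := ι) (α := ℂ)
  let _ := Matrix.linftyOpNormedAlgebra (n := ι) (R := ℂ) (α := ℂ)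
  rcases (spectrum ℂ M).eq_empty_or_nonempty with h0 | h0
  · simp [spectralRadius, h0]
  · obtain ⟨z, hz, hz'⟩ := spectrum.exists_nnnorm_eq_spectralRadius_of_nonempty h0
    rw [← hz']
    exact_mod_cast hspec z hz

/-- Gelfand's formula, as an exponential bound on the entries of the powers. -/
lemma exists_abs_pow_mulVec_le {M : Matrix ι ι ℝ} {r : ℝ} (hr : 0 < r)
    (h : spectralRadius ℂ (M.map Complex.ofReal) < ENNReal.ofReal r) (u : ι → ℝ) :
    ∃ C, 0 ≤ C ∧ ∀ᶠ n : ℕ in atTop, ∀ i, |((M ^ n) *ᵥ u) i| ≤ C * r ^ n := by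
  -- This operator norm is compatible with the sup norm on vectors, which gives entrywise bounds
  -- directly.
  let _ := Matrix.linftyOpNormedRing (n := ι) (α := ℂ)
  let _ := Matrix.linftyOpNormedAlgebra (n := ι) (R := ℂ) (α := ℂ)
  let v : ι → ℂ := fun i => (u i : ℂ)
  refine ⟨‖v‖, norm_nonneg _, ?_⟩
  have hg := spectrum.pow_nnnorm_pow_one_div_tendsto_nhds_spectralRadius (M.map Complex.ofReal)
  filter_upwards [hg.eventually_lt_const h, eventually_gt_atTop 0] with n hn hn0 i
  have h1 : ‖(M.map Complex.ofReal) ^ n‖ ≤ r ^ n := by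
    have h2 := ENNReal.rpow_le_rpow hn.le (Nat.cast_nonneg' (α := ℝ) n)
    rw [← ENNReal.rpow_mul, one_div_mul_cancel (by positivity), ENNReal.rpow_one,
      ENNReal.rpow_natCast, ← ENNReal.ofReal_pow hr.le] at h2
    rw [← coe_nnnorm]
    rw [ENNReal.ofReal, ENNReal.coe_le_coe] at h2
    have h3 : ((‖(M.map Complex.ofReal) ^ n‖₊ : NNReal) : ℝ) ≤ (r ^ n).toNNReal := by
      exact_mod_cast h2
    rwa [Real.coe_toNNReal _ (by positivity)] at h3
  have h4 : ((((M ^ n) *ᵥ u) i : ℝ) : ℂ) = ((M.map Complex.ofReal) ^ n *ᵥ v) i := by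
    rw [← map_ofReal_pow]
    simp [mulVec, dotProduct, v]
  calc |((M ^ n) *ᵥ u) i| = ‖((M.map Complex.ofReal) ^ n *ᵥ v) i‖ := by
        rw [← h4, Complex.norm_real, Real.norm_eq_abs]
    _ ≤ ‖(M.map Complex.ofReal) ^ n *ᵥ v‖ := norm_le_pi_norm _ i
    _ ≤ ‖(M.map Complex.ofReal) ^ n‖ * ‖v‖ := Matrix.linfty_opNorm_mulVec _ _
    _ ≤ ‖v‖ * r ^ n := by
      rw [mul_comm]; gcongr

end Deterministic

/-! ### The projection onto zero-sum vectors. -/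

section Averaging

variable {p : ℕ}

lemma averagingMatrix_mul {M : Matrix (Fin p) (Fin p) ℝ}
    (hM : M ∈ colStochastic ℝ (Fin p)) : averagingMatrix p * M = averagingMatrix p := by
  ext i j
  simp [averagingMatrix, mul_apply, ← Finset.mul_sum, (mem_colStochastic_iff_sum.1 hM).2 j]

lemma averagingMatrix_mem (hp : 0 < p) : averagingMatrix p ∈ colStochastic ℝ (Fin p) := by
  rw [mem_colStochastic_iff_sum]
  refine ⟨fun i j => by simp [averagingMatrix], fun j => ?_⟩
  have : (p : ℝ) ≠ 0 := by positivity
  simp [averagingMatrix, this]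

/-- The projection `I - J` along the all-ones vector onto the zero-sum vectors. -/
noncomputable def centering (p : ℕ) : Matrix (Fin p) (Fin p) ℝ := 1 - averagingMatrix p

/-- From `J M = J` and `J J = J` one gets `J M (I - J) = 0`: zero-sum vectors stay zero-sum under
`M`. -/
lemma centering_mul_mul (hp : 0 < p) {M : Matrix (Fin p) (Fin p) ℝ}
    (hM : M ∈ colStochastic ℝ (Fin p)) :
    centering p * (M * centering p) = M * centering p := by
  have h := averagingMatrix_mul (averagingMatrix_mem hp)
  have h2 := averagingMatrix_mul hM
  rw [centering, Matrix.sub_mul, Matrix.one_mul, ← Matrix.mul_assoc, h2, Matrix.mul_sub,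
    Matrix.mul_one, Matrix.mul_sub (averagingMatrix p), Matrix.mul_one, h]
  simp

lemma centering_mulVec (y : Fin p → ℝ) (hy : ∑ i, y i = 0) : centering p *ᵥ y = y := by
  rw [centering, Matrix.sub_mulVec, Matrix.one_mulVec, sub_eq_self]
  ext i
  simp [averagingMatrix, mulVec, dotProduct, ← Finset.mul_sum, hy]

lemma sum_centering (hp : 0 < p) (j : Fin p) : ∑ i, centering p i j = 0 := by
  have := (mem_colStochastic_iff_sum.1 (averagingMatrix_mem hp)).2 j
  simp [centering, Finset.sum_sub_distrib, this, Matrix.one_apply]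

lemma kronecker_mulVec_tensor {m : Type*} [Fintype m] (M N : Matrix m m ℝ) (x y : m → ℝ) :
    (M ⊗ₖ N) *ᵥ (fun q : m × m => x q.1 * y q.2) = fun q => (M *ᵥ x) q.1 * (N *ᵥ y) q.2 := by
  ext q
  simp only [mulVec, dotProduct, kroneckerMap_apply, Fintype.sum_prod_type, Finset.sum_mul_sum]
  refine Finset.sum_congr rfl fun i _ => Finset.sum_congr rfl fun j _ => by ring

end Averaging

/-! ### Positivity patterns of non-negative matrices. -/

section Pattern

lemma exists_pos_of_mul_apply_pos {m : Type*} [Fintype m] {M N : Matrix m m ℝ}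
    (hM : ∀ i j, 0 ≤ M i j) (hN : ∀ i j, 0 ≤ N i j) {i j : m} (h : 0 < (M * N) i j) :
    ∃ k, 0 < M i k ∧ 0 < N k j := by
  rw [mul_apply] at h
  obtain ⟨k, -, hk⟩ := Finset.exists_lt_of_sum_lt (s := Finset.univ)
    (f := fun _ => (0 : ℝ)) (g := fun k => M i k * N k j) (by simpa using h)
  exact ⟨k, (hM i k).lt_of_ne fun h0 => by simp [← h0] at hk,
    (hN k j).lt_of_ne fun h0 => by simp [← h0] at hk⟩

lemma mul_apply_pos {m : Type*} [Fintype m] {M N : Matrix m m ℝ} (hM : ∀ i j, 0 ≤ M i j)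
    (hN : ∀ i j, 0 ≤ N i j) {i k j : m} (h1 : 0 < M i k) (h2 : 0 < N k j) :
    0 < (M * N) i j := by
  rw [mul_apply]
  exact Finset.sum_pos' (fun _ _ => mul_nonneg (hM _ _) (hN _ _))
    ⟨k, Finset.mem_univ _, mul_pos h1 h2⟩

variable {p : ℕ}

/-- The matrices that are positive wherever `M` is. -/
def patternSet (M : Matrix (Fin p) (Fin p) ℝ) : Set (Matrix (Fin p) (Fin p) ℝ) :=
  {N | ∀ i j, 0 < M i j → 0 < N i j}

lemma isOpen_patternSet (M : Matrix (Fin p) (Fin p) ℝ) : IsOpen (patternSet M) := by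
  simp only [patternSet, Set.ofPred_forall]
  refine isOpen_iInter_of_finite fun i => isOpen_iInter_of_finite fun j =>
    isOpen_iInter_of_finite fun _ => ?_
  exact isOpen_lt continuous_const (continuous_id.matrix_elem i j)

lemma mul_mem_patternSet {M M' N N' : Matrix (Fin p) (Fin p) ℝ} (h : N ∈ patternSet M)
    (h' : N' ∈ patternSet M') (hM : ∀ i j, 0 ≤ M i j) (hM' : ∀ i j, 0 ≤ M' i j)
    (hN : ∀ i j, 0 ≤ N i j) (hN' : ∀ i j, 0 ≤ N' i j) : N * N' ∈ patternSet (M * M') := by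
  intro i j hij
  obtain ⟨k, h1, h2⟩ := exists_pos_of_mul_apply_pos hM hM' hij
  exact mul_apply_pos hN hN' (h i k h1) (h' k j h2)

end Pattern

/-! ### Second moments and almost sure decay of zero-sum trajectories. -/

section SecondMoment

variable {p : ℕ} {Ω : Type*} [MeasurableSpace Ω] {P : Measure Ω}
  {𝒜 : Set (Matrix (Fin p) (Fin p) ℝ)} {A : ℕ → Ω → Matrix (Fin p) (Fin p) ℝ}

lemma measurable_entry (i j : Fin p) :
    Measurable fun M : Matrix (Fin p) (Fin p) ℝ => M i j :=
  (continuous_id.matrix_elem i j).measurable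

lemma entry_mem_Icc {M : Matrix (Fin p) (Fin p) ℝ} (hM : M ∈ colStochastic ℝ (Fin p))
    (i j : Fin p) : M i j ∈ Set.Icc 0 1 :=
  ⟨hM.1 i j, le_one_of_mem_colStochastic hM⟩

lemma StandingAssumption.ae_colStochastic (hA : StandingAssumption P 𝒜 A) (n : ℕ) :
    ∀ᵐ ω ∂P, A n ω ∈ colStochastic ℝ (Fin p) :=
  (hA.mem n).mono fun _ h => hA.columnStochastic _ h

lemma StandingAssumption.integrable_kronecker [IsProbabilityMeasure P]
    (hA : StandingAssumption P 𝒜 A) (n : ℕ) (q r : Fin p × Fin p) :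
    Integrable (fun ω => (A n ω ⊗ₖ A n ω) q r) P := by
  refine Integrable.of_bound (C := 1) ?_ ?_
  · exact (((measurable_entry _ _).comp (hA.measurable n)).mul
      ((measurable_entry _ _).comp (hA.measurable n))).aestronglyMeasurable
  · filter_upwards [hA.ae_colStochastic n] with ω h
    have h1 := entry_mem_Icc h q.1 r.1
    have h2 := entry_mem_Icc h q.2 r.2
    rw [kroneckerMap_apply, Real.norm_of_nonneg (mul_nonneg h1.1 h2.1)]
    exact mul_le_one₀ h1.2 h2.1 h2.2

lemma mul_integral_mul_apply {m : Type*} [Fintype m] {F : Ω → Matrix m m ℝ}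
    (hF : ∀ i j, Integrable (fun ω => F ω i j) P) (S R : Matrix m m ℝ) (i j : m) :
    (S * ((Matrix.of fun a b => ∫ ω, F ω a b ∂P) * R)) i j = ∫ ω, (S * (F ω * R)) i j ∂P := by
  simp only [mul_apply, of_apply]
  rw [integral_finsetSum _ fun a _ =>
    (integrable_finsetSum _ fun b _ => (hF a b).mul_const _).const_mul _]
  refine Finset.sum_congr rfl fun a _ => ?_
  rw [integral_const_mul, integral_finsetSum _ fun b _ => (hF a b).mul_const _]
  simp_rw [integral_mul_const]

lemma StandingAssumption.centering_mul_expected [IsProbabilityMeasure P] (hp : 0 < p)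
    (hA : StandingAssumption P 𝒜 A) :
    (centering p ⊗ₖ centering p) *
        (expectedKroneckerSquare P (A 0) * (centering p ⊗ₖ centering p)) =
      expectedKroneckerSquare P (A 0) * (centering p ⊗ₖ centering p) := by
  ext i j
  have h2 := mul_integral_mul_apply (hA.integrable_kronecker 0) 1 (centering p ⊗ₖ centering p) i j
  rw [Matrix.one_mul] at h2
  rw [expectedKroneckerSquare, mul_integral_mul_apply (hA.integrable_kronecker 0), h2]
  refine integral_congr_ae ?_
  filter_upwards [hA.ae_colStochastic 0] with ω h
  rw [Matrix.one_mul, ← mul_kronecker_mul, ← mul_kronecker_mul, centering_mul_mul hp h]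

lemma StandingAssumption.expected_mem_colStochastic [IsProbabilityMeasure P]
    (hA : StandingAssumption P 𝒜 A) :
    expectedKroneckerSquare P (A 0) ∈ colStochastic ℝ (Fin p × Fin p) := by
  rw [mem_colStochastic_iff_sum]
  constructor
  · intro q r
    refine integral_nonneg_of_ae ?_
    filter_upwards [hA.ae_colStochastic 0] with ω h
    exact mul_nonneg (h.1 _ _) (h.1 _ _)
  · intro r
    simp only [expectedKroneckerSquare, of_apply]
    rw [← integral_finsetSum _ fun q _ => hA.integrable_kronecker 0 q r]
    rw [integral_congr_ae (g := fun _ => 1)]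
    · simp
    filter_upwards [hA.ae_colStochastic 0] with ω h
    simp [Fintype.sum_prod_type, ← Finset.sum_mul_sum, (mem_colStochastic_iff_sum.1 h).2]

/-- `patternSet M` is an open neighbourhood of `M`, which lies in the support of the common law. -/
lemma StandingAssumption.measure_patternSet_pos (hA : StandingAssumption P 𝒜 A) (n : ℕ)
    {M : Matrix (Fin p) (Fin p) ℝ} (hM : M ∈ 𝒜) : 0 < P (A n ⁻¹' patternSet M) := by
  have h1 := (Measure.mem_support_iff_forall M).1 (hA.fullSupport hM) (patternSet M)
    ((isOpen_patternSet M).mem_nhds fun _ _ h => h)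
  rwa [← (hA.identDistrib n).map_eq, Measure.map_apply (hA.measurable n)
    (isOpen_patternSet M).measurableSet] at h1

lemma StandingAssumption.expected_pos [IsProbabilityMeasure P] (hA : StandingAssumption P 𝒜 A)
    {M : Matrix (Fin p) (Fin p) ℝ} (hM : M ∈ 𝒜) {i j k l : Fin p} (h1 : 0 < M i k)
    (h2 : 0 < M j l) : 0 < expectedKroneckerSquare P (A 0) (i, j) (k, l) := by
  simp only [expectedKroneckerSquare, of_apply]
  rw [integral_pos_iff_support_of_nonneg_ae _ (hA.integrable_kronecker 0 _ _)]
  · refine (hA.measure_patternSet_pos 0 hM).trans_le (measure_mono fun ω hω => ?_)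
    exact (mul_pos (hω i k h1) (hω j l h2)).ne'
  · filter_upwards [hA.ae_colStochastic 0] with ω h
    exact mul_nonneg (h.1 _ _) (h.1 _ _)

/-- A positive entry of a product is a path of positive entries. The paths `i → k` and `j → l` use
the same letter at each step, so they combine into one path for the expected Kronecker square. -/
lemma StandingAssumption.expected_pow_pos [IsProbabilityMeasure P]
    (hA : StandingAssumption P 𝒜 A) (w : List (Matrix (Fin p) (Fin p) ℝ)) (hw : ∀ M ∈ w, M ∈ 𝒜) :
    ∀ i j k l, 0 < w.prod i k → 0 < w.prod j l →
      0 < (expectedKroneckerSquare P (A 0) ^ w.length) (i, j) (k, l) := by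
  induction w with
  | nil =>
    intro i j k l h1 h2
    have e1 : i = k := by by_contra h; simp [h] at h1
    have e2 : j = l := by by_contra h; simp [h] at h2
    simp [e1, e2]
  | cons M w ih =>
    intro i j k l h1 h2
    have hM := hw M (by simp)
    have hw' : ∀ N ∈ w, N ∈ 𝒜 := fun N hN => hw N (by simp [hN])
    have hMn := (hA.columnStochastic M hM).1
    have hwn := (Submonoid.list_prod_mem _ fun N hN => hA.columnStochastic N (hw' N hN)).1
    rw [List.prod_cons] at h1 h2
    obtain ⟨a, ha, ha'⟩ := exists_pos_of_mul_apply_pos hMn hwn h1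
    obtain ⟨b, hb, hb'⟩ := exists_pos_of_mul_apply_pos hMn hwn h2
    have hK := hA.expected_mem_colStochastic
    rw [List.length_cons, pow_succ']
    exact mul_apply_pos hK.1 (pow_mem hK _).1 (hA.expected_pos hM ha hb)
      (ih hw' _ _ _ _ ha' hb')

theorem StandingAssumption.spectralRadius_lt_one [IsProbabilityMeasure P] (hp : 0 < p)
    (hA : StandingAssumption P 𝒜 A) :
    spectralRadius ℂ ((expectedKroneckerSquare P (A 0) *
      (centering p ⊗ₖ centering p)).map Complex.ofReal) < 1 := by
  obtain ⟨w, -, hw, hpos⟩ := hA.primitive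
  refine spectralRadius_lt_one_of_forall fun μ v hv h => ?_
  rcases eq_or_ne μ 0 with rfl | hμ
  · simp
  have hQK := hA.centering_mul_expected hp
  set Q := centering p ⊗ₖ centering p
  set K := expectedKroneckerSquare P (A 0)
  -- As `Q K Q = K Q`, the vector `μ v` is fixed by `Q`; cancel `μ ≠ 0`. Hence `v` is also an
  -- eigenvector of `K`.
  have hQv : Q.map Complex.ofReal *ᵥ v = v := by
    have h1 : μ • (Q.map Complex.ofReal *ᵥ v) = μ • v := by
      rw [← mulVec_smul, ← h, mulVec_mulVec, ← map_ofReal_mul, hQK]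
    exact smul_right_injective _ hμ h1
  refine norm_lt_one_of_eigenvector hA.expected_mem_colStochastic (N := w.length)
    (fun q r => hA.expected_pow_pos w hw _ _ _ _ (hpos _ _) (hpos _ _)) hv ?_ (μ := μ) ?_
  · rw [← hQv]
    simp only [mulVec, dotProduct, map_apply]
    rw [Finset.sum_comm]
    refine Finset.sum_eq_zero fun r _ => ?_
    rw [← Finset.sum_mul, ← Complex.ofReal_sum]
    simp [Q, Fintype.sum_prod_type, ← Finset.mul_sum, sum_centering hp]
  · conv_lhs => rw [← hQv]
    rw [mulVec_mulVec, ← map_ofReal_mul, h]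

/-- The trajectory is determined by the matrices used so far. -/
lemma trajectory_congr {a b : ℕ → Matrix (Fin p) (Fin p) ℝ} (v : Fin p → ℝ) {n : ℕ}
    (h : ∀ k < n, a k = b k) : trajectory a v n = trajectory b v n := by
  induction n with
  | zero => rfl
  | succ n ih =>
    simp only [trajectory]
    rw [h n n.lt_succ_self, ih fun k hk => h k (hk.trans n.lt_succ_self)]

lemma measurable_trajectory {α : Type*} [MeasurableSpace α]
    {a : α → ℕ → Matrix (Fin p) (Fin p) ℝ} (ha : ∀ n, Measurable fun x => a x n)
    (v : Fin p → ℝ) (n : ℕ) (i : Fin p) : Measurable fun x => trajectory (a x) v n i := by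
  induction n generalizing i with
  | zero => exact measurable_const
  | succ n ih =>
    simp only [trajectory, mulVec, dotProduct]
    exact Finset.measurable_fun_sum _ fun j _ => ((measurable_entry i j).comp (ha n)).mul (ih j)

/-- Column-stochastic matrices do not increase the `ℓ¹` norm; this bound makes all second moments
integrable. -/
lemma sum_abs_trajectory_le {a : ℕ → Matrix (Fin p) (Fin p) ℝ}
    (ha : ∀ n, a n ∈ colStochastic ℝ (Fin p)) (v : Fin p → ℝ) (n : ℕ) :
    ∑ i, |trajectory a v n i| ≤ ∑ i, |v i| := by
  induction n with
  | zero => rfl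
  | succ n ih =>
    refine le_trans ?_ ih
    simp only [trajectory, mulVec, dotProduct]
    calc ∑ i, |∑ j, a n i j * trajectory a v n j|
        ≤ ∑ i, ∑ j, a n i j * |trajectory a v n j| := by
          refine Finset.sum_le_sum fun i _ => (Finset.abs_sum_le_sum_abs _ _).trans_eq ?_
          refine Finset.sum_congr rfl fun j _ => ?_
          rw [abs_mul, abs_of_nonneg ((ha n).1 i j)]
      _ = _ := by
          rw [Finset.sum_comm]
          refine Finset.sum_congr rfl fun j _ => ?_
          rw [← Finset.sum_mul, (mem_colStochastic_iff_sum.1 (ha n)).2 j, one_mul]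

lemma StandingAssumption.integrable_trajectory_mul [IsProbabilityMeasure P]
    (hA : StandingAssumption P 𝒜 A) (v : Fin p → ℝ) (n : ℕ) (i j : Fin p) :
    Integrable (fun ω => trajectory (fun k => A k ω) v n i * trajectory (fun k => A k ω) v n j)
      P := by
  refine Integrable.of_bound (C := (∑ i, |v i|) * ∑ i, |v i|) ?_ ?_
  · exact ((measurable_trajectory hA.measurable v n i).mul
      (measurable_trajectory hA.measurable v n j)).aestronglyMeasurable
  · filter_upwards [ae_all_iff.2 hA.ae_colStochastic] with ω h
    have hb : ∀ i, |trajectory (fun k => A k ω) v n i| ≤ ∑ i, |v i| := fun i =>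
      (Finset.single_le_sum (f := fun i => |trajectory (fun k => A k ω) v n i|)
        (fun _ _ => abs_nonneg _) (Finset.mem_univ i)).trans (sum_abs_trajectory_le h v n)
    rw [norm_mul]
    exact mul_le_mul (hb i) (hb j) (norm_nonneg _) ((abs_nonneg _).trans (hb i))

/-- The current matrix is independent of the past. -/
lemma StandingAssumption.indepFun_trajectory (hA : StandingAssumption P 𝒜 A) (v : Fin p → ℝ)
    (n : ℕ) (q r : Fin p × Fin p) :
    ProbabilityTheory.IndepFun (fun ω => (A n ω ⊗ₖ A n ω) q r)
      (fun ω => trajectory (fun k => A k ω) v n r.1 * trajectory (fun k => A k ω) v n r.2) P := by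
  classical
  have hind := hA.indep.indepFun_finset {n} (Finset.range n) (by simp) hA.measurable
  -- Padding the first `n` matrices with zeros exhibits the trajectory at time `n` as a measurable
  -- function of them alone.
  let ext : (Finset.range n → Matrix (Fin p) (Fin p) ℝ) → ℕ → Matrix (Fin p) (Fin p) ℝ :=
    fun b k => if h : k ∈ Finset.range n then b ⟨k, h⟩ else 0
  have hext : ∀ k, Measurable fun b => ext b k := by
    intro k
    by_cases h : k ∈ Finset.range n
    · simp only [ext, h, dite_true]; exact measurable_pi_apply _
    · simp only [ext, h, dite_false]; exact measurable_const
  let φ : (({n} : Finset ℕ) → Matrix (Fin p) (Fin p) ℝ) → ℝ := fun b =>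
    (b ⟨n, by simp⟩ ⊗ₖ b ⟨n, by simp⟩) q r
  have hφ : Measurable φ :=
    ((measurable_entry q.1 r.1).comp (measurable_pi_apply _)).mul
      ((measurable_entry q.2 r.2).comp (measurable_pi_apply _))
  have hψ : Measurable fun b => trajectory (ext b) v n r.1 * trajectory (ext b) v n r.2 :=
    (measurable_trajectory hext v n r.1).mul (measurable_trajectory hext v n r.2)
  have := hind.comp hφ hψ
  convert! this using 1
  ext ω
  have : trajectory (fun k => A k ω) v n =
      trajectory (ext fun i : Finset.range n => A i ω) v n := by
    refine trajectory_congr v fun k hk => ?_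
    simp [ext, hk]
  simp [this]

lemma StandingAssumption.integral_trajectory_mul [IsProbabilityMeasure P]
    (hA : StandingAssumption P 𝒜 A) (v : Fin p → ℝ) (n : ℕ) (q : Fin p × Fin p) :
    ∫ ω, trajectory (fun k => A k ω) v n q.1 * trajectory (fun k => A k ω) v n q.2 ∂P =
      ((expectedKroneckerSquare P (A 0) ^ n) *ᵥ fun r => v r.1 * v r.2) q := by
  induction n generalizing q with
  | zero => simp [trajectory]
  | succ n ih =>
    rw [pow_succ', ← mulVec_mulVec]
    have h1 : ∀ ω, trajectory (fun k => A k ω) v (n + 1) q.1 *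
        trajectory (fun k => A k ω) v (n + 1) q.2 = ∑ r, (A n ω ⊗ₖ A n ω) q r *
          (trajectory (fun k => A k ω) v n r.1 * trajectory (fun k => A k ω) v n r.2) := by
      intro ω
      exact (congrFun (kronecker_mulVec_tensor (A n ω) (A n ω)
        (trajectory (fun k => A k ω) v n) (trajectory (fun k => A k ω) v n)) q).symm
    have hind := hA.indepFun_trajectory v n q
    have hint : ∀ r, Integrable (fun ω => (A n ω ⊗ₖ A n ω) q r *
        (trajectory (fun k => A k ω) v n r.1 * trajectory (fun k => A k ω) v n r.2)) P := fun r =>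
      (hind r).integrable_mul (hA.integrable_kronecker n q r)
        (hA.integrable_trajectory_mul v n _ _)
    rw [integral_congr_ae (Eventually.of_forall h1), integral_finsetSum _ fun r _ => hint r]
    simp only [mulVec, dotProduct]
    refine Finset.sum_congr rfl fun r _ => ?_
    rw [(hind r).integral_fun_mul_eq_mul_integral
      (hA.integrable_kronecker n q r).aestronglyMeasurable
      (hA.integrable_trajectory_mul v n _ _).aestronglyMeasurable, ih r]
    congr 1
    exact ((hA.identDistrib n).comp (u := fun M => (M ⊗ₖ M) q r)
      ((measurable_entry q.1 r.1).mul (measurable_entry q.2 r.2))).integral_eq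

lemma StandingAssumption.pow_mulVec_tensor [IsProbabilityMeasure P] (hp : 0 < p)
    (hA : StandingAssumption P 𝒜 A) {v : Fin p → ℝ} (hv : ∑ i, v i = 0) (n : ℕ) :
    (expectedKroneckerSquare P (A 0) ^ n) *ᵥ (fun r => v r.1 * v r.2) =
      ((expectedKroneckerSquare P (A 0) * (centering p ⊗ₖ centering p)) ^ n) *ᵥ
        fun r => v r.1 * v r.2 := by
  have hQK := hA.centering_mul_expected hp
  have hQv : (centering p ⊗ₖ centering p) *ᵥ (fun r => v r.1 * v r.2) =
      fun r => v r.1 * v r.2 := by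
    rw [kronecker_mulVec_tensor, centering_mulVec v hv]
  set Q := centering p ⊗ₖ centering p
  set K := expectedKroneckerSquare P (A 0)
  set u : Fin p × Fin p → ℝ := fun r => v r.1 * v r.2
  -- The induction must also carry invariance under `Q`, which allows a `Q` to be inserted before
  -- the next `K`.
  suffices h : (K ^ n) *ᵥ u = ((K * Q) ^ n) *ᵥ u ∧ Q *ᵥ ((K * Q) ^ n *ᵥ u) = (K * Q) ^ n *ᵥ u from
    h.1
  induction n with
  | zero => simp [hQv]
  | succ n ih =>
    rw [pow_succ', pow_succ' (K * Q), ← mulVec_mulVec, ih.1, ← mulVec_mulVec]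
    constructor
    · rw [← mulVec_mulVec, ih.2]
    · rw [mulVec_mulVec _ Q, hQK]

theorem StandingAssumption.second_moment_le [IsProbabilityMeasure P] (hp : 0 < p)
    (hA : StandingAssumption P 𝒜 A) {r : ℝ} (hr : 0 < r)
    (h : spectralRadius ℂ ((expectedKroneckerSquare P (A 0) *
      (centering p ⊗ₖ centering p)).map Complex.ofReal) < ENNReal.ofReal r)
    {v : Fin p → ℝ} (hv : ∑ i, v i = 0) :
    ∃ C, 0 ≤ C ∧ ∀ᶠ n : ℕ in atTop, ∀ i,
      ∫ ω, trajectory (fun k => A k ω) v n i ^ 2 ∂P ≤ C * r ^ n := by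
  obtain ⟨C, hC, hb⟩ := exists_abs_pow_mulVec_le hr h fun r => v r.1 * v r.2
  refine ⟨C, hC, hb.mono fun n hn i => ?_⟩
  simp_rw [pow_two]
  rw [hA.integral_trajectory_mul v n (i, i), hA.pow_mulVec_tensor hp hv]
  exact (le_abs_self _).trans (hn _)

/-- Almost surely, a zero-sum trajectory decays at least as fast as the root of its second
moment. -/
theorem StandingAssumption.ae_eventually_abs_trajectory_le [IsProbabilityMeasure P] (hp : 0 < p)
    (hA : StandingAssumption P 𝒜 A) {r s : ℝ} (hr : 0 < r) (hrs : r < s ^ 2) (hs : 0 < s)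
    (h : spectralRadius ℂ ((expectedKroneckerSquare P (A 0) *
      (centering p ⊗ₖ centering p)).map Complex.ofReal) < ENNReal.ofReal r)
    {v : Fin p → ℝ} (hv : ∑ i, v i = 0) :
    ∀ᵐ ω ∂P, ∀ᶠ n : ℕ in atTop, ∀ i, |trajectory (fun k => A k ω) v n i| ≤ s ^ n := by
  obtain ⟨C, hC, hb⟩ := hA.second_moment_le hp hr h hv
  suffices hi : ∀ i, ∀ᵐ ω ∂P, ∀ᶠ n : ℕ in atTop, |trajectory (fun k => A k ω) v n i| ≤ s ^ n by
    filter_upwards [ae_all_iff.2 hi] with ω hω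
    exact eventually_all.2 hω
  intro i
  obtain ⟨N, hN⟩ := eventually_atTop.1 hb
  let E : ℕ → Set Ω := fun n => {ω | (s ^ 2) ^ n ≤ trajectory (fun k => A k ω) v n i ^ 2}
  -- Markov's inequality for the square; the bound is summable because `r < s ^ 2`, so
  -- Borel–Cantelli applies to the events from `N` on.
  have hE : ∀ n ≥ N, P (E n) ≤ ENNReal.ofReal (C * (r / s ^ 2) ^ n) := by
    intro n hn
    have hint : Integrable (fun ω => trajectory (fun k => A k ω) v n i ^ 2) P := by
      simpa only [pow_two] using hA.integrable_trajectory_mul v n i i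
    have hm := mul_meas_ge_le_integral_of_nonneg (μ := P)
      (Eventually.of_forall fun ω => sq_nonneg (trajectory (fun k => A k ω) v n i)) hint
      ((s ^ 2) ^ n)
    rw [← ofReal_measureReal (μ := P) (s := E n)]
    refine ENNReal.ofReal_le_ofReal ?_
    rw [div_pow, mul_div_assoc', le_div_iff₀ (by positivity), mul_comm]
    exact hm.trans (hN n hn i)
  have hsum : Summable fun n : ℕ => C * (r / s ^ 2) ^ n :=
    (summable_geometric_of_lt_one (by positivity) ((div_lt_one (by positivity)).2 hrs)).mul_left C
  have hfin : ∑' n, P (E (n + N)) ≠ ⊤ := by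
    refine ne_top_of_le_ne_top ?_ (ENNReal.tsum_le_tsum fun n => hE (n + N) (Nat.le_add_left _ _))
    exact ((summable_nat_add_iff N).2 hsum).tsum_ofReal_ne_top
  filter_upwards [ae_eventually_notMem hfin] with ω hω
  obtain ⟨m, hm⟩ := eventually_atTop.1 hω
  filter_upwards [eventually_ge_atTop (m + N)] with n hn
  have h1 := hm (n - N) (by omega)
  rw [Nat.sub_add_cancel (by omega)] at h1
  have h2 : trajectory (fun k => A k ω) v n i ^ 2 < (s ^ n) ^ 2 := by
    rw [← pow_mul, mul_comm, pow_mul]; exact not_le.1 h1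
  exact (abs_lt_of_sq_lt_sq h2 (by positivity)).le

end SecondMoment

open Topology

/-! ### Products over time windows and lower bounds for the weights. -/

section Window

variable {p : ℕ}

/-- The product `a (m + k - 1) * ⋯ * a m` of `k` consecutive matrices. -/
noncomputable def windowProd (a : ℕ → Matrix (Fin p) (Fin p) ℝ) (m : ℕ) :
    ℕ → Matrix (Fin p) (Fin p) ℝ
  | 0 => 1
  | k + 1 => a (m + k) * windowProd a m k

lemma windowProd_congr {a b : ℕ → Matrix (Fin p) (Fin p) ℝ} {m k : ℕ}
    (h : ∀ i < k, a (m + i) = b (m + i)) : windowProd a m k = windowProd b m k := by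
  induction k with
  | zero => rfl
  | succ k ih =>
    simp only [windowProd]
    rw [h k k.lt_succ_self, ih fun i hi => h i (hi.trans k.lt_succ_self)]

lemma windowProd_add (a : ℕ → Matrix (Fin p) (Fin p) ℝ) (m k l : ℕ) :
    windowProd a m (k + l) = windowProd a (m + k) l * windowProd a m k := by
  induction l with
  | zero => simp [windowProd]
  | succ l ih => rw [← add_assoc, windowProd, ih, windowProd, Matrix.mul_assoc, add_assoc]

lemma trajectory_add (a : ℕ → Matrix (Fin p) (Fin p) ℝ) (v : Fin p → ℝ) (m k : ℕ) :
    trajectory a v (m + k) = windowProd a m k *ᵥ trajectory a v m := by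
  induction k with
  | zero => simp [windowProd]
  | succ k ih => rw [← add_assoc, trajectory, ih, windowProd, mulVec_mulVec]

lemma windowProd_mem_colStochastic {a : ℕ → Matrix (Fin p) (Fin p) ℝ}
    (ha : ∀ n, a n ∈ colStochastic ℝ (Fin p)) (m k : ℕ) :
    windowProd a m k ∈ colStochastic ℝ (Fin p) := by
  induction k with
  | zero => exact one_mem _
  | succ k ih => exact mul_mem (ha _) ih

lemma trajectory_one_nonneg {a : ℕ → Matrix (Fin p) (Fin p) ℝ}
    (ha : ∀ n, a n ∈ colStochastic ℝ (Fin p)) (n : ℕ) (i : Fin p) : 0 ≤ trajectory a 1 n i := by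
  induction n generalizing i with
  | zero => simp [trajectory]
  | succ n ih =>
    simp only [trajectory, mulVec, dotProduct]
    exact Finset.sum_nonneg fun j _ => mul_nonneg ((ha n).1 i j) (ih j)

lemma sum_trajectory {a : ℕ → Matrix (Fin p) (Fin p) ℝ}
    (ha : ∀ n, a n ∈ colStochastic ℝ (Fin p)) (v : Fin p → ℝ) (n : ℕ) :
    ∑ i, trajectory a v n i = ∑ i, v i := by
  induction n with
  | zero => rfl
  | succ n ih =>
    rw [← ih]
    simp only [trajectory, mulVec, dotProduct]
    rw [Finset.sum_comm]
    refine Finset.sum_congr rfl fun j _ => ?_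
    rw [← Finset.sum_mul, (mem_colStochastic_iff_sum.1 (ha n)).2 j, one_mul]

lemma windowProd_allowable {a : ℕ → Matrix (Fin p) (Fin p) ℝ}
    (ha : ∀ n, a n ∈ colStochastic ℝ (Fin p)) (hal : ∀ n, Allowable (a n)) (m k : ℕ) :
    Allowable (windowProd a m k) := by
  induction k with
  | zero => exact ⟨fun i => ⟨i, by simp [windowProd]⟩, fun i => ⟨i, by simp [windowProd]⟩⟩
  | succ k ih =>
    have h0 := (windowProd_mem_colStochastic ha m k).1
    constructor
    · intro i
      obtain ⟨l, hl⟩ := (hal (m + k)).1 i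
      obtain ⟨j, hj⟩ := ih.1 l
      exact ⟨j, mul_apply_pos (ha _).1 h0 hl hj⟩
    · intro j
      obtain ⟨l, hl⟩ := ih.2 j
      obtain ⟨i, hi⟩ := (hal (m + k)).2 l
      exact ⟨i, mul_apply_pos (ha _).1 h0 hi hl⟩

/-- A window containing a block with positive product has a positive product. -/
lemma windowProd_pos_of_block {a : ℕ → Matrix (Fin p) (Fin p) ℝ}
    (ha : ∀ n, a n ∈ colStochastic ℝ (Fin p)) (hal : ∀ n, Allowable (a n)) {m k s l : ℕ}
    (hms : m ≤ s) (hsl : s + l ≤ m + k) (hpos : ∀ i j, 0 < windowProd a s l i j) (i j : Fin p) :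
    0 < windowProd a m k i j := by
  obtain ⟨u, rfl⟩ := Nat.exists_eq_add_of_le hms
  obtain ⟨t, rfl⟩ : ∃ t, k = u + l + t := ⟨k - (u + l), by omega⟩
  rw [windowProd_add, windowProd_add]
  have hcs := fun m k => (windowProd_mem_colStochastic ha m k).1
  obtain ⟨x, hx⟩ := (windowProd_allowable ha hal (m + (u + l)) t).1 i
  obtain ⟨y, hy⟩ := (windowProd_allowable ha hal m u).2 j
  exact mul_apply_pos (hcs _ _) (mul_mem (windowProd_mem_colStochastic ha _ _)
    (windowProd_mem_colStochastic ha _ _)).1 hx (mul_apply_pos (hcs _ _) (hcs _ _) (hpos x y) hy)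

lemma exp_logMinus_minNonzeroEntry_le {M : Matrix (Fin p) (Fin p) ℝ} (hM : ∀ i j, 0 ≤ M i j)
    {i j : Fin p} (h : 0 < M i j) : Real.exp (logMinus (minNonzeroEntry M)) ≤ M i j := by
  let S := {t : ℝ | ∃ i j, M i j = t ∧ M i j ≠ 0}
  have hfin : S.Finite := (Set.finite_range fun q : Fin p × Fin p => M q.1 q.2).subset
    fun t ⟨a, b, h, _⟩ => ⟨(a, b), h⟩
  have hmem : M i j ∈ S := ⟨i, j, rfl, h.ne'⟩
  obtain ⟨a, b, hab, hne⟩ := Set.Nonempty.csInf_mem ⟨_, hmem⟩ hfin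
  have hpos : 0 < minNonzeroEntry M := by
    rw [minNonzeroEntry, ← hab]
    exact (hM a b).lt_of_ne hne.symm
  calc Real.exp (logMinus (minNonzeroEntry M)) ≤ Real.exp (Real.log (minNonzeroEntry M)) :=
        Real.exp_le_exp.2 (min_le_left _ _)
    _ = minNonzeroEntry M := Real.exp_log hpos
    _ ≤ M i j := csInf_le hfin.bddBelow hmem

/-- A positive entry contains at least one path of positive entries, each bounded below by the
smallest non-zero entry of its matrix. -/
lemma exp_sum_le_windowProd {a : ℕ → Matrix (Fin p) (Fin p) ℝ}
    (ha : ∀ n, a n ∈ colStochastic ℝ (Fin p)) (m k : ℕ) {i j : Fin p}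
    (h : 0 < windowProd a m k i j) :
    Real.exp (∑ t ∈ Finset.range k, logMinus (minNonzeroEntry (a (m + t)))) ≤
      windowProd a m k i j := by
  induction k generalizing i with
  | zero =>
    have : i = j := by by_contra hne; simp [windowProd, hne] at h
    subst this
    simp [windowProd]
  | succ k ih =>
    have hcs := (windowProd_mem_colStochastic ha m k).1
    obtain ⟨l, h1, h2⟩ := exists_pos_of_mul_apply_pos (ha (m + k)).1 hcs h
    rw [Finset.sum_range_succ, Real.exp_add, mul_comm, windowProd, mul_apply]
    refine le_trans ?_ (Finset.single_le_sum (f := fun l => a (m + k) i l * windowProd a m k l j)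
      (fun l _ => mul_nonneg ((ha _).1 i l) (hcs l j)) (Finset.mem_univ l))
    exact mul_le_mul (exp_logMinus_minNonzeroEntry_le (ha _).1 h1) (ih h2) (Real.exp_pos _).le
      h1.le

/-- The weights at time `m` are non-negative with total mass `p ≥ 1`, and an all-positive window
passes a fixed share of that mass to every coordinate. -/
lemma exp_sum_le_trajectory_one {a : ℕ → Matrix (Fin p) (Fin p) ℝ}
    (ha : ∀ n, a n ∈ colStochastic ℝ (Fin p)) (m k : ℕ)
    (h : ∀ i j, 0 < windowProd a m k i j) (i : Fin p) :
    Real.exp (∑ t ∈ Finset.range k, logMinus (minNonzeroEntry (a (m + t)))) ≤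
      trajectory a 1 (m + k) i := by
  set b := Real.exp (∑ t ∈ Finset.range k, logMinus (minNonzeroEntry (a (m + t))))
  have hp : (1 : ℝ) ≤ p := by exact_mod_cast i.pos
  calc b ≤ b * p := le_mul_of_one_le_right (Real.exp_pos _).le hp
    _ = ∑ j, b * trajectory a 1 m j := by
      rw [← Finset.mul_sum, sum_trajectory ha]; simp
    _ ≤ ∑ j, windowProd a m k i j * trajectory a 1 m j := Finset.sum_le_sum fun j _ =>
      mul_le_mul_of_nonneg_right (exp_sum_le_windowProd ha m k (h i j))
        (trajectory_one_nonneg ha m j)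
    _ = _ := by rw [trajectory_add]; rfl

lemma tendsto_comp_div {u : ℕ → ℝ} {f : ℕ → ℕ} {c b : ℝ} (hb : 0 < b)
    (hu : Tendsto (fun n : ℕ => u n / n) atTop (𝓝 c))
    (hf : Tendsto (fun n : ℕ => (f n : ℝ) / n) atTop (𝓝 b)) :
    Tendsto (fun n : ℕ => u (f n) / n) atTop (𝓝 (c * b)) := by
  have hf' : Tendsto f atTop atTop := by
    rw [← tendsto_natCast_atTop_iff (R := ℝ)]
    refine (hf.pos_mul_atTop hb (tendsto_natCast_atTop_atTop (R := ℝ))).congr' ?_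
    filter_upwards [eventually_gt_atTop 0] with n hn
    field_simp
  refine ((hu.comp hf').mul hf).congr' ?_
  filter_upwards [hf'.eventually_gt_atTop 0] with n hn
  have : (f n : ℝ) ≠ 0 := by exact_mod_cast hn.ne'
  simp only [Function.comp]
  field_simp

lemma tendsto_floor_mul_div {b : ℝ} (hb : 0 ≤ b) :
    Tendsto (fun n : ℕ => ((⌊b * n⌋₊ : ℕ) : ℝ) / n) atTop (𝓝 b) :=
  (tendsto_nat_floor_mul_div_atTop hb).comp tendsto_natCast_atTop_atTop

/-- If the logarithms of the smallest entries satisfy a law of large numbers and blocks with a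
positive product have a positive density, the weights decay subexponentially. -/
theorem eventually_exp_le_trajectory_one {a : ℕ → Matrix (Fin p) (Fin p) ℝ}
    (ha : ∀ n, a n ∈ colStochastic ℝ (Fin p)) (hal : ∀ n, Allowable (a n)) {c q : ℝ} (hq : 0 < q)
    {L : ℕ} (hL : 0 < L)
    (hlog : Tendsto (fun n : ℕ => (∑ k ∈ Finset.range n, logMinus (minNonzeroEntry (a k))) / n)
      atTop (𝓝 c))
    {D : ℕ → ℝ} (hD : ∀ j, D j ≠ 0 → ∀ i k, 0 < windowProd a (j * L) L i k)
    (hblock : Tendsto (fun n : ℕ => (∑ j ∈ Finset.range n, D j) / n) atTop (𝓝 q))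
    {δ : ℝ} (hδ : 0 < δ) :
    ∀ᶠ n : ℕ in atTop, ∀ i, Real.exp (-δ * n) ≤ trajectory a 1 n i := by
  have hL' : (0 : ℝ) < L := by exact_mod_cast hL
  -- The window from about `θ n` to `n` has log-sum about `c (1 - θ) n`, so `θ` close to `1` makes
  -- the loss less than `δ n`.
  obtain ⟨θ, hθ0, hθ1, hθc⟩ : ∃ θ : ℝ, 0 < θ ∧ θ < 1 ∧ -δ < c * 1 - c * θ := by
    have hlim : Tendsto (fun θ : ℝ => c * 1 - c * θ) (𝓝[<] 1) (𝓝 0) := by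
      have : ContinuousAt (fun θ : ℝ => c * 1 - c * θ) 1 := by fun_prop
      simpa using this.tendsto.mono_left nhdsWithin_le_nhds
    have h1 := hlim.eventually_const_lt (neg_lt_zero.2 hδ)
    have h2 : ∀ᶠ θ : ℝ in 𝓝[<] 1, θ ∈ Set.Ioo (0 : ℝ) 1 := Ioo_mem_nhdsLT one_pos
    obtain ⟨θ, h1, h2⟩ := (h1.and h2).exists
    exact ⟨θ, h2.1, h2.2, h1⟩
  let j₁ : ℕ → ℕ := fun n => ⌊θ / L * n⌋₊
  let j₂ : ℕ → ℕ := fun n => ⌊1 / L * (n : ℝ)⌋₊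
  have hj₁ : Tendsto (fun n : ℕ => (j₁ n : ℝ) / n) atTop (𝓝 (θ / L)) :=
    tendsto_floor_mul_div (by positivity)
  have hj₂ : Tendsto (fun n : ℕ => (j₂ n : ℝ) / n) atTop (𝓝 (1 / L)) :=
    tendsto_floor_mul_div (by positivity)
  have hj₁L : Tendsto (fun n : ℕ => ((j₁ n * L : ℕ) : ℝ) / n) atTop (𝓝 θ) := by
    have := hj₁.mul_const (L : ℝ)
    rw [div_mul_cancel₀ _ hL'.ne'] at this
    refine this.congr fun n => ?_
    push_cast; ring
  have hone : Tendsto (fun n : ℕ => ((n : ℕ) : ℝ) / n) atTop (𝓝 1) := by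
    refine tendsto_const_nhds.congr' ?_
    filter_upwards [eventually_gt_atTop 0] with n hn
    have : (n : ℝ) ≠ 0 := by positivity
    field_simp
  have hblk := (tendsto_comp_div (by positivity) hblock hj₂).sub
    (tendsto_comp_div (by positivity) hblock hj₁)
  have hblk0 : 0 < q * (1 / L) - q * (θ / L) := by
    rw [← mul_sub, ← sub_div]
    exact mul_pos hq (div_pos (sub_pos.2 hθ1) hL')
  have hwin := (tendsto_comp_div one_pos hlog hone).sub (tendsto_comp_div hθ0 hlog hj₁L)
  filter_upwards [hblk.eventually_const_lt hblk0, hwin.eventually_const_lt hθc,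
    eventually_gt_atTop 0] with n hn1 hn2 hn0 i
  have hn0' : (0 : ℝ) < n := by exact_mod_cast hn0
  have hj12 : j₁ n ≤ j₂ n := Nat.floor_mono (by gcongr)
  have hj2n : j₂ n * L ≤ n := by
    have h := Nat.floor_le (a := 1 / L * (n : ℝ)) (by positivity)
    have : ((j₂ n * L : ℕ) : ℝ) ≤ n := by
      push_cast
      calc (j₂ n : ℝ) * L ≤ 1 / L * n * L := by gcongr
        _ = n := by field_simp
    exact_mod_cast this
  -- If every `D j` in this range vanished, the two partial sums would agree, against the positive
  -- limit of their scaled difference.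
  obtain ⟨j, hj1, hj2, hDj⟩ : ∃ j, j₁ n ≤ j ∧ j < j₂ n ∧ D j ≠ 0 := by
    by_contra! hcon
    rw [← sub_div, ← Finset.sum_Ico_eq_sub _ hj12, Finset.sum_eq_zero fun j hj =>
      hcon j (Finset.mem_Ico.1 hj).1 (Finset.mem_Ico.1 hj).2] at hn1
    simp at hn1
  have hm : j₁ n * L ≤ n := (Nat.mul_le_mul_right L hj12).trans hj2n
  obtain ⟨k, hk⟩ := Nat.exists_eq_add_of_le hm
  have hjL : j * L + L ≤ j₂ n * L := by
    rw [← Nat.succ_mul]; exact Nat.mul_le_mul_right L hj2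
  have hpos := windowProd_pos_of_block ha hal (m := j₁ n * L) (k := k) (s := j * L) (l := L)
    (Nat.mul_le_mul_right L hj1) (by omega) (hD j hDj)
  have hfin := exp_sum_le_trajectory_one ha (j₁ n * L) k hpos i
  rw [← hk] at hfin
  refine le_trans (Real.exp_le_exp.2 ?_) hfin
  rw [← sub_div, lt_div_iff₀ hn0'] at hn2
  refine hn2.le.trans_eq ?_
  conv_lhs => rw [hk]
  rw [← hk, sub_eq_iff_eq_add']
  conv_lhs => rw [hk]
  exact Finset.sum_range_add _ _ _

lemma windowProd_mem_patternSet {a b : ℕ → Matrix (Fin p) (Fin p) ℝ}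
    (ha : ∀ n, a n ∈ colStochastic ℝ (Fin p)) (hb : ∀ n, b n ∈ colStochastic ℝ (Fin p))
    {m k : ℕ} (h : ∀ i < k, a (m + i) ∈ patternSet (b i)) :
    windowProd a m k ∈ patternSet (windowProd b 0 k) := by
  induction k with
  | zero => exact fun _ _ h => h
  | succ k ih =>
    refine mul_mem_patternSet (by simpa using h k k.lt_succ_self)
      (ih fun i hi => h i (hi.trans k.lt_succ_self)) (hb _).1
      (windowProd_mem_colStochastic hb _ _).1 (ha _).1 (windowProd_mem_colStochastic ha _ _).1

lemma exists_seq_windowProd_eq {𝒜 : Set (Matrix (Fin p) (Fin p) ℝ)} (hne : 𝒜.Nonempty)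
    (w : List (Matrix (Fin p) (Fin p) ℝ)) (hw : ∀ M ∈ w, M ∈ 𝒜) :
    ∃ b : ℕ → Matrix (Fin p) (Fin p) ℝ, (∀ n, b n ∈ 𝒜) ∧ windowProd b 0 w.length = w.prod := by
  induction w with
  | nil => exact ⟨fun _ => hne.some, fun _ => hne.some_mem, rfl⟩
  | cons M w ih =>
    obtain ⟨b, hb, hb'⟩ := ih fun N hN => hw N (by simp [hN])
    -- The head of the list is the leftmost factor, hence the last matrix applied. Values beyond the
    -- word only need to lie in `𝒜`.
    refine ⟨Function.update b w.length M, fun n => ?_, ?_⟩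
    · rcases eq_or_ne n w.length with rfl | h
      · simpa using hw M (by simp)
      · simpa [h] using hb n
    · rw [List.length_cons, List.prod_cons, windowProd, ← hb', zero_add, Function.update_self,
        windowProd_congr (b := b)]
      intro i hi
      simp [hi.ne]

lemma PrimitiveSet.exists_seq {𝒜 : Set (Matrix (Fin p) (Fin p) ℝ)} (h : PrimitiveSet 𝒜) :
    ∃ (L : ℕ) (b : ℕ → Matrix (Fin p) (Fin p) ℝ), 0 < L ∧ (∀ n, b n ∈ 𝒜) ∧
      ∀ i j, 0 < windowProd b 0 L i j := by
  obtain ⟨w, hne, hw, hpos⟩ := h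
  obtain ⟨M, hM⟩ := List.exists_mem_of_ne_nil w hne
  obtain ⟨b, hb, hb'⟩ := exists_seq_windowProd_eq ⟨M, hw M hM⟩ w hw
  exact ⟨w.length, b, List.length_pos_iff.2 hne, hb, by rwa [hb']⟩

/-- An infimum over a fixed finite index set is visibly measurable in `M`. The default `1` for zero
entries is harmless because all entries are at most `1`. -/
lemma minNonzeroEntry_eq_iInf (hp : 0 < p) {M : Matrix (Fin p) (Fin p) ℝ}
    (hM : M ∈ colStochastic ℝ (Fin p)) (hal : Allowable M) :
    minNonzeroEntry M = ⨅ q : Fin p × Fin p, if M q.1 q.2 = 0 then 1 else M q.1 q.2 := by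
  obtain ⟨j, hj⟩ := hal.1 ⟨0, hp⟩
  have : Nonempty (Fin p × Fin p) := ⟨(j, j)⟩
  have hbdd : BddBelow {t : ℝ | ∃ i j, M i j = t ∧ M i j ≠ 0} :=
    ⟨0, fun t ⟨a, b, h, _⟩ => h ▸ hM.1 a b⟩
  refine le_antisymm (le_ciInf fun q => ?_) (le_csInf ⟨_, _, j, rfl, hj.ne'⟩ ?_)
  · split_ifs with h
    · exact (csInf_le hbdd ⟨_, j, rfl, hj.ne'⟩).trans (entry_mem_Icc hM _ _).2
    · exact csInf_le hbdd ⟨_, _, rfl, h⟩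
  · rintro t ⟨a, b, rfl, h⟩
    refine (ciInf_le (Set.finite_range _).bddBelow (a, b)).trans_eq ?_
    simp [h]

end Window

/-! ### Laws of large numbers for the entries and for the positive blocks. -/

section Random

open ProbabilityTheory

variable {p : ℕ} {Ω : Type*} [MeasurableSpace Ω] {P : Measure Ω}
  {𝒜 : Set (Matrix (Fin p) (Fin p) ℝ)} {A : ℕ → Ω → Matrix (Fin p) (Fin p) ℝ}

lemma StandingAssumption.ae_tendsto_logMinus (hp : 0 < p) (hA : StandingAssumption P 𝒜 A) :
    ∃ c : ℝ, ∀ᵐ ω ∂P, Tendsto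
      (fun n : ℕ => (∑ k ∈ Finset.range n, logMinus (minNonzeroEntry (A k ω))) / n)
      atTop (𝓝 c) := by
  let f : Matrix (Fin p) (Fin p) ℝ → ℝ := fun M =>
    logMinus (⨅ q : Fin p × Fin p, if M q.1 q.2 = 0 then 1 else M q.1 q.2)
  have hf : Measurable f := by
    refine (Real.measurable_log.comp (Measurable.iInf fun q => ?_)).min measurable_const
    exact Measurable.ite (measurable_entry q.1 q.2 (measurableSet_singleton 0)) measurable_const
      (measurable_entry q.1 q.2)
  have hfA : ∀ k, ∀ᵐ ω ∂P, logMinus (minNonzeroEntry (A k ω)) = f (A k ω) := fun k => by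
    filter_upwards [hA.mem k] with ω h
    rw [minNonzeroEntry_eq_iInf hp (hA.columnStochastic _ h) (hA.allowable _ h)]
  have hslln := strong_law_ae_real (fun k ω => f (A k ω)) (hA.logIntegrable.congr (hfA 0))
    (fun i j hij => (hA.indep.indepFun hij).comp hf hf) fun i => (hA.identDistrib i).comp hf
  refine ⟨∫ ω, f (A 0 ω) ∂P, ?_⟩
  filter_upwards [hslln, ae_all_iff.2 hfA] with ω h1 h2
  simpa only [h2] using h1

/-- Almost surely, blocks with a positive product occur with a positive density. -/
lemma StandingAssumption.ae_tendsto_block [IsProbabilityMeasure P]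
    (hA : StandingAssumption P 𝒜 A) :
    ∃ (L : ℕ) (q : ℝ) (D : ℕ → Ω → ℝ), 0 < L ∧ 0 < q ∧
      (∀ᵐ ω ∂P, ∀ j, D j ω ≠ 0 →
        ∀ i k, 0 < windowProd (fun n => A n ω) (j * L) L i k) ∧
      ∀ᵐ ω ∂P, Tendsto (fun n : ℕ => (∑ j ∈ Finset.range n, D j ω) / n) atTop (𝓝 q) := by
  obtain ⟨L, b, hL, hb, hpos⟩ := hA.primitive.exists_seq
  let S : Set (Fin L → Matrix (Fin p) (Fin p) ℝ) := {x | ∀ i : Fin L, x i ∈ patternSet (b i)}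
  have hS : MeasurableSet S := by
    simp only [S, Set.ofPred_forall]
    exact MeasurableSet.iInter fun i =>
      measurable_pi_apply i (isOpen_patternSet (b i)).measurableSet
  let φ : (Fin L → Matrix (Fin p) (Fin p) ℝ) → ℝ := S.indicator 1
  have hφ : Measurable φ := measurable_one.indicator hS
  let X : ℕ → Ω → Fin L → Matrix (Fin p) (Fin p) ℝ := fun j ω i => A (j * L + i) ω
  have hX : ∀ j, Measurable (X j) := fun j => measurable_pi_lambda _ fun i => hA.measurable _
  have hinj : ∀ j, Function.Injective fun i : Fin L => j * L + (i : ℕ) := fun j i i' h =>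
    Fin.ext (by simpa using h)
  have hident : ∀ j, IdentDistrib (X j) (X 0) P P := fun j =>
    IdentDistrib.pi (fun i => (hA.identDistrib _).trans (hA.identDistrib _).symm)
      (hA.indep.precomp (hinj j)) (hA.indep.precomp (hinj 0))
  -- Distinct blocks use disjoint sets of times; `x / L` recovers the block containing `x`.
  have hindep : Pairwise fun i j => IndepFun (fun ω => φ (X i ω)) (fun ω => φ (X j ω)) P := by
    intro j j' hjj'
    have hdisj : Disjoint (Finset.Ico (j * L) (j * L + L)) (Finset.Ico (j' * L) (j' * L + L)) := by
      rw [Finset.disjoint_left]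
      intro x hx hx'
      rw [Finset.mem_Ico] at hx hx'
      refine hjj' ?_
      have e1 : x / L = j := Nat.div_eq_of_lt_le (by omega) (by rw [Nat.succ_mul]; omega)
      have e2 : x / L = j' := Nat.div_eq_of_lt_le (by omega) (by rw [Nat.succ_mul]; omega)
      exact e1.symm.trans e2
    let ψ : ∀ j, ((Finset.Ico (j * L) (j * L + L) : Finset ℕ) → Matrix (Fin p) (Fin p) ℝ) →
        Fin L → Matrix (Fin p) (Fin p) ℝ := fun j x i =>
      x ⟨j * L + i, Finset.mem_Ico.2 ⟨by omega, by omega⟩⟩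
    have hψ : ∀ j, Measurable (ψ j) := fun j =>
      measurable_pi_lambda _ fun i => measurable_pi_apply _
    exact (hA.indep.indepFun_finset _ _ hdisj hA.measurable).comp (hφ.comp (hψ j))
      (hφ.comp (hψ j'))
  have hbdd : Integrable (fun ω => φ (X 0 ω)) P := by
    refine Integrable.of_bound (C := 1) (hφ.comp (hX 0)).aestronglyMeasurable ?_
    refine Eventually.of_forall fun ω => ?_
    by_cases h : X 0 ω ∈ S <;> simp [φ, h]
  have hslln := strong_law_ae_real (fun j ω => φ (X j ω)) hbdd hindep
    fun j => (hident j).comp hφ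
  refine ⟨L, _, fun j ω => φ (X j ω), hL, ?_, ?_, hslln⟩
  · have hset : X 0 ⁻¹' S =
        ⋂ i ∈ (Finset.univ : Finset (Fin L)), A (0 * L + i) ⁻¹' patternSet (b i) := by
      ext ω
      simp [X, S]
    have hmeas : 0 < P (X 0 ⁻¹' S) := by
      rw [hset, (hA.indep.precomp (hinj 0)).measure_inter_preimage_eq_mul
        (sets := fun i : Fin L => patternSet (b i))
        Finset.univ fun i _ => (isOpen_patternSet (b i)).measurableSet]
      exact CanonicallyOrderedAdd.prod_pos.2 fun i _ => hA.measure_patternSet_pos _ (hb i)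
    have hint : ∫ ω, φ (X 0 ω) ∂P = P.real (X 0 ⁻¹' S) := integral_indicator_one (hX 0 hS)
    rw [hint]
    exact ENNReal.toReal_pos hmeas.ne' (measure_ne_top _ _)
  · filter_upwards [ae_all_iff.2 hA.ae_colStochastic] with ω hω j hj i k
    have hmem : X j ω ∈ S := by
      by_contra h
      exact hj (by simp [φ, h])
    exact windowProd_mem_patternSet hω (fun n => hA.columnStochastic _ (hb n))
      (fun i hi => hmem ⟨i, hi⟩) i k (hpos i k)

theorem StandingAssumption.ae_eventually_exp_le_trajectory_one [IsProbabilityMeasure P]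
    (hp : 0 < p) (hA : StandingAssumption P 𝒜 A) {δ : ℝ} (hδ : 0 < δ) :
    ∀ᵐ ω ∂P, ∀ᶠ n : ℕ in atTop, ∀ i,
      Real.exp (-δ * n) ≤ trajectory (fun k => A k ω) 1 n i := by
  obtain ⟨c, hc⟩ := hA.ae_tendsto_logMinus hp
  obtain ⟨L, q, D, hL, hq, hD, hlim⟩ := hA.ae_tendsto_block
  filter_upwards [hc, hD, hlim, ae_all_iff.2 hA.mem] with ω h1 h2 h3 h4
  exact eventually_exp_le_trajectory_one (fun n => hA.columnStochastic _ (h4 n))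
    (fun n => hA.allowable _ (h4 n)) hq hL h1 h2 h3 hδ

end Random

/-! ### From trajectories to the consensus error. -/

section Error

variable {p : ℕ}

lemma trajectory_sub_smul (a : ℕ → Matrix (Fin p) (Fin p) ℝ) (x w : Fin p → ℝ) (c : ℝ) (n : ℕ) :
    trajectory a (x - c • w) n = trajectory a x n - c • trajectory a w n := by
  induction n with
  | zero => rfl
  | succ n ih => simp only [trajectory, ih, mulVec_sub, mulVec_smul]

lemma sum_sub_average (hp : 0 < p) (x : Fin p → ℝ) :
    ∑ i, (x - average x • (1 : Fin p → ℝ)) i = 0 := by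
  have : (p : ℝ) ≠ 0 := by positivity
  simp [average, Finset.sum_sub_distrib, mul_div_cancel₀ _ this]

lemma consensusError_le {a : ℕ → Matrix (Fin p) (Fin p) ℝ} {x : Fin p → ℝ} {n : ℕ} {s t : ℝ}
    (ht : 0 < t)
    (hx : ∀ i, |trajectory a (x - average x • (1 : Fin p → ℝ)) n i| ≤ s)
    (hw : ∀ i, t ≤ trajectory a 1 n i) : consensusError a x n ≤ p * (s / t) := by
  have h : ∀ i, |trajectory a x n i / trajectory a 1 n i - average x| ≤ s / t := by
    intro i
    have hwi := ht.trans_le (hw i)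
    have : trajectory a x n i / trajectory a 1 n i - average x =
        trajectory a (x - average x • (1 : Fin p → ℝ)) n i / trajectory a 1 n i := by
      rw [trajectory_sub_smul]
      simp only [Pi.sub_apply, Pi.smul_apply, smul_eq_mul]
      field_simp
    rw [this, abs_div, abs_of_pos hwi]
    exact div_le_div₀ ((abs_nonneg _).trans (hx i)) (hx i) ht (hw i)
  calc consensusError a x n ≤ ∑ _i : Fin p, s / t := Finset.sum_le_sum fun i _ => h i
    _ = p * (s / t) := by simp

variable {Ω : Type*} [MeasurableSpace Ω] {P : Measure Ω} [IsProbabilityMeasure P]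
  {𝒜 : Set (Matrix (Fin p) (Fin p) ℝ)} {A : ℕ → Ω → Matrix (Fin p) (Fin p) ℝ}

theorem StandingAssumption.ae_eventually_consensusError_le (hp : 0 < p)
    (hA : StandingAssumption P 𝒜 A) (x₀ : Fin p → ℝ) {c : ℝ} (hc : etaTwo P (A 0) / 2 < c) :
    ∀ᵐ ω ∂P, ∀ᶠ n : ℕ in atTop,
      consensusError (fun k => A k ω) x₀ n ≤ Real.exp (c * n) := by
  have hρ : spectralRadius ℂ ((expectedKroneckerSquare P (A 0) *
      (centering p ⊗ₖ centering p)).map Complex.ofReal) < ENNReal.ofReal (Real.exp c ^ 2) := by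
    rw [EReal.div_lt_iff (by norm_num) (by decide)] at hc
    rw [← ENNReal.log_lt_log_iff, ENNReal.log_ofReal_of_pos (by positivity), Real.log_pow,
      Real.log_exp]
    refine hc.trans_eq ?_
    rw [EReal.coe_mul, mul_comm]
    rfl
  obtain ⟨r, hr0, hρr, hrc⟩ := ENNReal.lt_iff_exists_real_btwn.1 hρ
  have hr : 0 < r := ENNReal.ofReal_pos.1 (bot_le.trans_lt hρr)
  have hrc' : √r < Real.exp c := by
    rw [Real.sqrt_lt' (Real.exp_pos c)]
    exact (ENNReal.ofReal_lt_ofReal_iff (by positivity)).1 hrc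
  obtain ⟨s, hrs, hsc⟩ := exists_between hrc'
  have hs : 0 < s := (Real.sqrt_nonneg r).trans_lt hrs
  have hlog : Real.log s < c := (Real.log_lt_iff_lt_exp hs).2 hsc
  -- Half of the gap pays for the decay of the weights and the other half absorbs the factor `p`:
  -- `log s + 2 δ = c`.
  set δ := (c - Real.log s) / 2 with hδ
  have hδ0 : 0 < δ := by rw [hδ]; linarith
  filter_upwards [hA.ae_eventually_abs_trajectory_le hp hr ((Real.sqrt_lt' hs).1 hrs) hs hρr
    (sum_sub_average hp x₀), hA.ae_eventually_exp_le_trajectory_one hp hδ0] with ω h1 h2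
  have h3 : ∀ᶠ n : ℕ in atTop, (p : ℝ) ≤ Real.exp (δ * n) :=
    (Real.tendsto_exp_atTop.comp
      (tendsto_natCast_atTop_atTop.const_mul_atTop hδ0)).eventually_ge_atTop _
  filter_upwards [h1, h2, h3] with n h1 h2 h3
  refine (consensusError_le (Real.exp_pos _) h1 h2).trans ?_
  have hsn : s ^ n = Real.exp (Real.log s * n) := by
    rw [mul_comm, Real.exp_nat_mul, Real.exp_log hs]
  rw [hsn, ← Real.exp_sub]
  calc (p : ℝ) * Real.exp (Real.log s * n - -δ * n)
      ≤ Real.exp (δ * n) * Real.exp (Real.log s * n - -δ * n) := by gcongr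
    _ = Real.exp (c * n) := by
      rw [← Real.exp_add]
      congr 1
      rw [hδ]; ring

end Error

end RatioConsensus

/-! ### The main theorem. -/

theorem theorem1 {p : ℕ} (hp : 0 < p) {Ω : Type*} [MeasurableSpace Ω] (P : Measure Ω)
    [IsProbabilityMeasure P] (𝒜 : Set (Matrix (Fin p) (Fin p) ℝ))
    (A : ℕ → Ω → Matrix (Fin p) (Fin p) ℝ) (hA : RatioConsensus.StandingAssumption P 𝒜 A)
    (x₀ : Fin p → ℝ) :
    (∀ᵐ ω ∂P,
      limsup (fun n : ℕ =>
        ENNReal.log (ENNReal.ofReal (RatioConsensus.consensusError (fun k => A k ω) x₀ n))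
          / (n : EReal)) atTop
        ≤ RatioConsensus.etaTwo P (A 0) / 2) ∧
    RatioConsensus.etaTwo P (A 0) / 2 < 0 := by
  constructor
  -- Rational rates keep the exceptional null sets countable in number, and also cover `η₂ = -∞`.
  · have h : ∀ᵐ ω ∂P, ∀ c : ℚ, RatioConsensus.etaTwo P (A 0) / 2 < ((c : ℝ) : EReal) →
        ∀ᶠ n : ℕ in atTop,
          RatioConsensus.consensusError (fun k => A k ω) x₀ n ≤ Real.exp (c * n) := by
      rw [ae_all_iff]
      intro c
      by_cases hc : RatioConsensus.etaTwo P (A 0) / 2 < ((c : ℝ) : EReal)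
      · filter_upwards [hA.ae_eventually_consensusError_le hp x₀ hc] with ω h _ using h
      · exact Eventually.of_forall fun ω h => absurd h hc
    filter_upwards [h] with ω hω
    by_contra! hlt
    obtain ⟨c, hc1, hc2⟩ := EReal.lt_iff_exists_rat_btwn.1 hlt
    refine hc2.not_ge (limsup_le_of_le (h := ?_))
    filter_upwards [hω c hc1, eventually_gt_atTop 0] with n hn hn0
    rw [EReal.div_le_iff_le_mul (by exact_mod_cast hn0) (EReal.natCast_ne_top n)]
    refine (ENNReal.log_le_log (ENNReal.ofReal_le_ofReal hn)).trans_eq ?_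
    rw [ENNReal.log_ofReal_of_pos (Real.exp_pos _), Real.log_exp, mul_comm, EReal.coe_mul]
    rfl
  · rw [EReal.div_lt_iff (by norm_num) (by decide), zero_mul]
    exact ENNReal.log_lt_zero_iff.2 (hA.spectralRadius_lt_one hp)
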